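/- **Setting.** Let $\mathfrak S=(X,W,f)$ be a discrete-time uncertain system with nonempty $X\subseteq\mathbb R^n$, $W\subseteq\mathbb R^m$ and $f:X\times W\to X$. Let $\mathsf{AP}$ be a finite set, $\Sigma=2^{\mathsf{AP}}$, $L:X\to\Sigma$ a labelling, and let $T(\mathfrak S,L)\subseteq\Sigma^\omega$ be the set of all traces $(L(\mathbf x(t)))_{t\in\mathbb N}$ of runs $\mathbf x(t+1)=f(\mathbf x(t),\nu(t))$, with arbitrary $\mathbf x(0)\in X$ and $\nu:\mathbb N\to W$. Write $f^p$ and $L^p$ for the componentwise maps $X^p\times W^p\to X^p$ and $X^p\to\Sigma^p$. Let $\phi=\forall\pi_1\ldots\forall\pi_l\exists\pi_{l+1}\ldots\exists\pi_p\,\psi$ be a HyperLTL formula with $\psi$ quantifier-free (an LTL formula over propositions $a_{\pi_i}$), and write $\mu_1\ldots\mu_p$ for its quantifiers. For letters $s_A,s_B\in\Sigma^p$, an *augmented barrier certificate* (ABC) for $(s_A,s_B)$ is a function $\mathcal B:X^p\to\mathbb R$ with $\mathcal B\le 0$ on $\{\tilde x: L^p(\tilde x)=s_A\}$, $\mathcal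 B>0$ on $\{\tilde x:L^p(\tilde x)=s_B\}$, and $$\forall x_1\in X\ \mu_1w_1\in W\ \ldots\ \forall x_p\in X\ \mu_pw_p\in W:\quad \mathcal B(f^p(\tilde x,\tilde w))-\mathcal B(\tilde x)\le 0 .$$ Let $\mathcal A=(\Sigma^p,Q,q_0,\Delta,\{(G_1,B_1),\ldots,(G_h,B_h)\})$ be any deterministic Rabin automaton (finite $Q$, total $\Delta:Q\times\Sigma^p\to Q$; a word is accepted iff for some $i$ its run visits some state of $G_i$ infinitely often and no state of $B_i$ infinitely often) that accepts the zip of $(\sigma_1,\ldots,\sigma_p)$ if and only if $(\pi_i\mapsto\sigma_i)_{i}\models\neg\psi$. A *lasso* of $\mathcal A$ is a sequence of transitions (each given by its source, letter and target) consisting of a simple path from $q_0$ to some $g\in G_1\cup\cdots\cup G_h$, followed by a nonempty simple cycle from $g$ to $g$; a path or cycle is *simple* if it repeats no transition. Let $\mathcal R$ be the set of lassos, and let $\Delta'$ be $\Delta$ restricted to the transitions between states that lie on lassos. **Procedure.** Start with $V=\mathit{visited}=\{q_0\}$ and $\mathcal R_d=\emptyset$. While $V\ne\emptyset$, take any $r\in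 V$. For every letter $s_A$, choose a set $S_a$ of pairs $(s_A,s_B)$ such that $r'=\Delta'(r,s_A)$ and $r''=\Delta'(r',s_B)$ are defined and such that all pairs in $S_a$ have a common ABC ($S_a=\emptyset$ is allowed; different $s_A$ and different $r$ may use different ABCs). Add to $\mathcal R_d$ every lasso in which, for some chosen pair $(s_A,s_B)$, the transition $r\xrightarrow{s_A}r'$ is immediately followed by $r'\xrightarrow{s_B}r''$. If $\mathcal R_d=\mathcal R$, return "$T(\mathfrak S,L)\models\phi$". Otherwise add to $V$ and to $\mathit{visited}$ every unvisited $r'=\Delta'(r,s_A)$ for which the transition from $r$ with letter $s_A$ lies on a lasso in $\mathcal R\setminus\mathcal R_d$, and remove $r$ from $V$. When $V=\emptyset$, return "Inconclusive". **Lemma.** The set $\mathcal R$ is finite; every execution of the procedure terminates with one of its two answers, whatever choices are made; and the procedure is sound: if some execution returns "$T(\mathfrak S,L)\models\phi$", then indeed $T(\mathfrak S,L)\models\phi$. -/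

import Mathlib

namespace HyperABC

open Filter

/-! ### Linear temporal logic and HyperLTL -/

/-- LTL formulas over the atomic propositions `P`. -/
inductive LTL (P : Type*) where
  | atom : P → LTL P
  | neg : LTL P → LTL P
  | or : LTL P → LTL P → LTL P
  | next : LTL P → LTL P
  | until : LTL P → LTL P → LTL P

/-- An infinite trace over the alphabet `2^AP`. -/
abbrev Trace (AP : Type*) := ℕ → Set AP

/-- A trace valuation for the trace variables `Var`. -/
abbrev Valuation (AP Var : Type*) := Var → Trace AP

/-- The suffix of a trace valuation from position `i` on. -/
def Valuation.suffix {AP Var : Type*} (V : Valuation AP Var) (i : ℕ) : Valuation AP Var :=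
  fun v k => V v (i + k)

/-- Satisfaction of a quantifier-free HyperLTL formula (an LTL formula whose atomic propositions
are indexed by trace variables) by a trace valuation. -/
def LTL.Sat {AP Var : Type*} : LTL (AP × Var) → Valuation AP Var → Prop
  | .atom a, V => a.1 ∈ V a.2 0
  | .neg ψ, V => ¬ ψ.Sat V
  | .or ψ₁ ψ₂, V => ψ₁.Sat V ∨ ψ₂.Sat V
  | .next ψ, V => ψ.Sat (V.suffix 1)
  | .until ψ₁ ψ₂, V => ∃ i, ψ₂.Sat (V.suffix i) ∧ ∀ j < i, ψ₁.Sat (V.suffix j)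

/-- HyperLTL formulas: trace quantifiers in front of a quantifier-free formula. -/
inductive HyperLTL (AP Var : Type*) where
  | ex : Var → HyperLTL AP Var → HyperLTL AP Var
  | all : Var → HyperLTL AP Var → HyperLTL AP Var
  | qf : LTL (AP × Var) → HyperLTL AP Var

/-- Satisfaction of a HyperLTL formula over the set `T` of traces under a trace valuation. -/
def HyperLTL.SatVal {AP Var : Type*} [DecidableEq Var] (T : Set (Trace AP)) :
    HyperLTL AP Var → Valuation AP Var → Prop
  | .ex v φ, V => ∃ σ ∈ T, φ.SatVal T (Function.update V v σ)
  | .all v φ, V => ∀ σ ∈ T, φ.SatVal T (Function.update V v σ)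
  | .qf ψ, V => ψ.Sat V

/-- `T ⊨ φ` for a closed formula `φ`; its truth does not depend on the valuation. -/
def HyperLTL.Models {AP Var : Type*} [DecidableEq Var] (T : Set (Trace AP))
    (φ : HyperLTL AP Var) : Prop :=
  ∀ V : Valuation AP Var, φ.SatVal T V

/-- A trace quantifier. -/
inductive Quant where
  | all
  | ex

/-- The formula `μ₁ π₁ … μₚ πₚ ψ`, whose trace variables are the elements of `Fin p`. -/
def prenex {AP : Type*} {p : ℕ} (μ : Fin p → Quant) (ψ : LTL (AP × Fin p)) :
    HyperLTL AP (Fin p) :=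
  (List.finRange p).foldr
    (fun i φ => match μ i with
      | .all => .all i φ
      | .ex => .ex i φ)
    (.qf ψ)

/-- The quantifier prefix of length `p` consisting of `l` universal quantifiers followed by
existential ones. -/
def forallExists (p l : ℕ) : Fin p → Quant :=
  fun i => if i.val < l then .all else .ex

/-! ### Discrete-time uncertain dynamical systems -/

/-- A system `(X, W, f)` with `X ⊆ ℝⁿ`, `W ⊆ ℝᵐ` and `f : X × W → X`. -/
structure System (n m : ℕ) where
  X : Set (EuclideanSpace ℝ (Fin n))
  W : Set (EuclideanSpace ℝ (Fin m))
  f : X → W → X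

namespace System

variable {n m : ℕ}

/-- The run from `x₀` under the input sequence `ν`. -/
def run (S : System n m) (x₀ : S.X) (ν : ℕ → S.W) : ℕ → S.X
  | 0 => x₀
  | t + 1 => S.f (S.run x₀ ν t) (ν t)

/-- The set of all traces of the system under the labelling `L`. -/
def traces {AP : Type*} (S : System n m) (L : S.X → Set AP) : Set (Trace AP) :=
  {σ | ∃ (x₀ : S.X) (ν : ℕ → S.W), σ = fun t => L (S.run x₀ ν t)}

/-- The transition function of the `p`-fold augmented system. -/
def augStep (S : System n m) {p : ℕ} (x : Fin p → S.X) (w : Fin p → S.W) : Fin p → S.X :=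
  fun i => S.f (x i) (w i)

end System

/-- Letters of the alphabet `Σᵖ` with `Σ = 2^AP`. -/
abbrev Letter (AP : Type*) (p : ℕ) := Fin p → Set AP

/-- The labelling `Lᵖ` of the augmented system. -/
def augLabel {AP X : Type*} (L : X → Set AP) {p : ℕ} (x : Fin p → X) : Letter AP p :=
  fun i => L (x i)

/-! ### Augmented barrier certificates -/

/-- `∀ x₁, μ₁ w₁, ∀ x₂, μ₂ w₂, …, ∀ xₚ, μₚ wₚ, P (x₁, …, xₚ) (w₁, …, wₚ)`. -/
def Alternating {X W : Type*} :
    (p : ℕ) → (Fin p → Quant) → ((Fin p → X) → (Fin p → W) → Prop) → Prop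
  | 0, _, P => P Fin.elim0 Fin.elim0
  | k + 1, μ, P => ∀ x : X,
      match μ 0 with
      | .all => ∀ w : W, Alternating k (fun i => μ i.succ)
          (fun xs ws => P (Fin.cons x xs) (Fin.cons w ws))
      | .ex => ∃ w : W, Alternating k (fun i => μ i.succ)
          (fun xs ws => P (Fin.cons x xs) (Fin.cons w ws))

/-- `b` is an augmented barrier certificate from `A` to `B` for the quantifier prefix `μ`. -/
def IsABC {n m p : ℕ} (S : System n m) (μ : Fin p → Quant) (A B : Set (Fin p → S.X))
    (b : (Fin p → S.X) → ℝ) : Prop :=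
  (∀ x ∈ A, b x ≤ 0) ∧ (∀ x ∈ B, 0 < b x) ∧
    Alternating p μ (fun x w => b (S.augStep x w) - b x ≤ 0)

/-- `b` is an augmented barrier certificate for the pair `(s_A, s_B)` of letters, i.e. for the
conditional invariance `μ₁ π₁ … μₚ πₚ □ (s_A → □ ¬ s_B)`. -/
def IsABCForPair {AP : Type*} {n m p : ℕ} (S : System n m) (L : S.X → Set AP)
    (μ : Fin p → Quant) (sA sB : Letter AP p) (b : (Fin p → S.X) → ℝ) : Prop :=
  IsABC S μ {x | augLabel L x = sA} {x | augLabel L x = sB} b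

/-! ### Deterministic automata, Rabin acceptance, lassos -/

/-- A deterministic complete transition structure with an initial state. -/
structure DetAut (α Q : Type*) where
  start : Q
  step : Q → α → Q

namespace DetAut

variable {α Q : Type*}

/-- The run on an infinite word. -/
def run (D : DetAut α Q) (w : ℕ → α) : ℕ → Q
  | 0 => D.start
  | t + 1 => D.step (D.run w t) (w t)

/-- `D.IsPath q es q'`: the transitions `es` (each given by its source and its letter; the target
is determined by them) lead from `q` to `q'`. -/
def IsPath (D : DetAut α Q) : Q → List (Q × α) → Q → Prop
  | q, [], q' => q = q'
  | q, e :: es, q' => e.1 = q ∧ D.IsPath (D.step e.1 e.2) es q'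

end DetAut

/-- A deterministic Rabin automaton with the acceptance pairs `(G i, B i)`, `i < h`. -/
structure DRA (α Q : Type*) extends DetAut α Q where
  h : ℕ
  G : Fin h → Set Q
  B : Fin h → Set Q

/-- The states that occur infinitely often in `r`. -/
def infStates {Q : Type*} (r : ℕ → Q) : Set Q := {q | ∃ᶠ t in atTop, r t = q}

/-- Rabin acceptance. -/
def DRA.Accepts {α Q : Type*} (D : DRA α Q) (w : ℕ → α) : Prop :=
  ∃ i, (infStates (D.run w) ∩ D.G i).Nonempty ∧ infStates (D.run w) ∩ D.B i = ∅

/-- The automaton recognizes exactly the zipped tuples of traces that violate `ψ`. -/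
def DRA.RecognizesNeg {AP Q : Type*} {p : ℕ} (D : DRA (Letter AP p) Q)
    (ψ : LTL (AP × Fin p)) : Prop :=
  ∀ V : Valuation AP (Fin p), D.Accepts (fun t i => V i t) ↔ (LTL.neg ψ).Sat V

/-- The states in some `G i`, which the lassos of the procedure have to reach and to cycle on.
(For a Büchi automaton, viewed as the Rabin automaton with the single pair `(F, ∅)`, these are
the accepting states.) -/
def DRA.targets {α Q : Type*} (D : DRA α Q) : Set Q := ⋃ i, D.G i

/-- The data of a lasso: the transitions of its stem and those of its cycle. -/
structure Lasso (α Q : Type*) where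
  stem : List (Q × α)
  cycle : List (Q × α)

/-- The transitions along a lasso. -/
def Lasso.edges {α Q : Type*} (ρ : Lasso α Q) : List (Q × α) := ρ.stem ++ ρ.cycle

section Procedure

variable {AP Q : Type*} {n m p : ℕ}

/-- The lassos of `D` with respect to the set `F` of target states: a simple path (no transition
is repeated) from the initial state to some `g ∈ F`, followed by a simple nonempty cycle on `g`. -/
def lassos {α Q : Type*} (D : DetAut α Q) (F : Set Q) : Set (Lasso α Q) :=
  {ρ | ∃ g ∈ F, D.IsPath D.start ρ.stem g ∧ ρ.stem.Nodup ∧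
    D.IsPath g ρ.cycle g ∧ ρ.cycle ≠ [] ∧ ρ.cycle.Nodup}

/-- The states that lie on a lasso. -/
def lassoStates {α Q : Type*} (D : DetAut α Q) (F : Set Q) : Set Q :=
  {q | ∃ ρ ∈ lassos D F, ∃ e ∈ ρ.edges, q = e.1 ∨ q = D.step e.1 e.2}

/-- `q' = Δ' (q, s)` in the pruned automaton, from which the states that are not on any lasso
have been removed, together with all transitions to and from them. -/
def PrunedStep {α Q : Type*} (D : DetAut α Q) (F : Set Q) (q : Q) (s : α) (q' : Q) : Prop :=
  q ∈ lassoStates D F ∧ q' ∈ lassoStates D F ∧ D.step q s = q'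

/-- One call of `ABC_FIND` at the state `r` selects, for every letter `s_A`, a set `c s_A` of
letters `s_B` such that all pairs `(s_A, s_B)` with `s_B ∈ c s_A` label two successive transitions
of the pruned automaton, the first of which leaves `r`, and admit a common ABC. Different letters
`s_A` (and different states `r`) may use different ABCs. -/
def IsSelection (S : System n m) (L : S.X → Set AP) (μ : Fin p → Quant)
    (D : DetAut (Letter AP p) Q) (F : Set Q) (r : Q)
    (c : Letter AP p → Set (Letter AP p)) : Prop :=
  ∀ sA, (∀ sB ∈ c sA, ∃ r' r'', PrunedStep D F r sA r' ∧ PrunedStep D F r' sB r'') ∧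
    ∃ b : (Fin p → S.X) → ℝ, ∀ sB ∈ c sA, IsABCForPair S L μ sA sB b

/-- The lassos denied by the selection `c` made at `r`: those along which a transition from `r`
with some letter `s_A` is directly followed by a transition with a letter in `c s_A`. -/
def denied {α Q : Type*} (D : DetAut α Q) (F : Set Q) (r : Q) (c : α → Set α) :
    Set (Lasso α Q) :=
  {ρ | ρ ∈ lassos D F ∧ ∃ sA, ∃ sB ∈ c sA, [(r, sA), (D.step r sA, sB)] <:+: ρ.edges}

/-- Configurations of the procedure: either it is running, with the set `V` of states that are
waiting, the set of states visited so far and the set `Rd` of lassos denied so far, or it has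
returned one of its two answers. -/
inductive Config (α Q : Type*) where
  | running (V visited : Set Q) (Rd : Set (Lasso α Q))
  | verified
  | inconclusive

/-- The initial configuration. -/
def initConfig {α Q : Type*} (D : DetAut α Q) : Config α Q :=
  .running {D.start} {D.start} ∅

/-- The states that are added to the waiting list after `r` has been processed: the unvisited
successors of `r` along the lassos that are not yet denied. -/
def newStates {α Q : Type*} (D : DetAut α Q) (F : Set Q) (r : Q) (visited : Set Q)
    (Rd : Set (Lasso α Q)) : Set Q :=
  {r' | r' ∉ visited ∧ ∃ sA, PrunedStep D F r sA r' ∧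
    ∃ ρ ∈ lassos D F \ Rd, (r, sA) ∈ ρ.edges}

/-- One iteration of the procedure. The waiting state that is processed and the selection made by
the oracle are arbitrary. -/
inductive Step (S : System n m) (L : S.X → Set AP) (μ : Fin p → Quant)
    (D : DetAut (Letter AP p) Q) (F : Set Q) :
    Config (Letter AP p) Q → Config (Letter AP p) Q → Prop
  | accept (V visited : Set Q) (Rd : Set (Lasso (Letter AP p) Q)) (r : Q)
      (c : Letter AP p → Set (Letter AP p)) (hr : r ∈ V) (hc : IsSelection S L μ D F r c)
      (hdone : lassos D F \ (Rd ∪ denied D F r c) = ∅) :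
      Step S L μ D F (.running V visited Rd) .verified
  | continue (V visited : Set Q) (Rd : Set (Lasso (Letter AP p) Q)) (r : Q)
      (c : Letter AP p → Set (Letter AP p)) (hr : r ∈ V) (hc : IsSelection S L μ D F r c)
      (hrest : lassos D F \ (Rd ∪ denied D F r c) ≠ ∅) :
      Step S L μ D F (.running V visited Rd)
        (.running ((V ∪ newStates D F r visited (Rd ∪ denied D F r c)) \ {r})
          (visited ∪ newStates D F r visited (Rd ∪ denied D F r c))
          (Rd ∪ denied D F r c))
  | giveUp (visited : Set Q) (Rd : Set (Lasso (Letter AP p) Q)) :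
      Step S L μ D F (.running ∅ visited Rd) .inconclusive

/-- The configuration `C` occurs in some execution of the procedure. -/
def Reaches (S : System n m) (L : S.X → Set AP) (μ : Fin p → Quant)
    (D : DetAut (Letter AP p) Q) (F : Set Q) (C : Config (Letter AP p) Q) : Prop :=
  Relation.ReflTransGen (Step S L μ D F) (initConfig D) C

/-- Every execution of the procedure ends after finitely many iterations, and it ends with one of
the two answers. -/
def Terminates (S : System n m) (L : S.X → Set AP) (μ : Fin p → Quant)
    (D : DetAut (Letter AP p) Q) (F : Set Q) : Prop :=
  (¬ ∃ C : ℕ → Config (Letter AP p) Q,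
      C 0 = initConfig D ∧ ∀ k, Step S L μ D F (C k) (C (k + 1))) ∧
    ∀ C, Reaches S L μ D F C →
      C = .verified ∨ C = .inconclusive ∨ ∃ C', Step S L μ D F C C'

end Procedure

end HyperABC

/-!
An execution of the procedure processes every state `r` at most once, because a processed state
is visited and no longer waiting. When it answers that the property holds, it has therefore fixed
one selection `c r` for every state (the empty one for states that were never processed), and every
lasso is denied by one of them (`exists_selection_of_reaches_verified`).

The inputs of the existentially quantified traces are chosen step by step. If the automaton is in
the state `q` and the augmented system is in a state `x` with label `sA`, then `c q sA` has a common
certificate `b`, and `b x ≤ 0`. The quantified decrease condition provides inputs for the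
existential components, given those of the universal ones, such that `b` is still nonpositive one
step later; the next label is then not in `c q sA` (`IsSelection.exists_input`). Only one step is
ever taken with a certificate, so it does not matter that the certificates of different states and
letters ask for different inputs. In the resulting word, no two successive transitions are of the
kind that denies a lasso.

If the automaton accepted this word, its run would visit some target state twice, hence consist of
a path to the target, a closed path on it, and a remainder. Cutting out a segment between two
occurrences of the same *transition* creates no new pair of successive transitions and keeps the
first and the last transition (`DetAut.IsPath.exists_nodup`). So both paths can be made simple,
which gives a lasso that no selection denies, a contradiction.

Termination holds because the number of unvisited states plus the number of waiting states drops
with every iteration.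
-/

namespace HyperABC

/-! ### Paths and lassos -/

section Paths

variable {α Q : Type*}

theorem DetAut.isPath_append (D : DetAut α Q) {q q' : Q} {es fs : List (Q × α)} :
    D.IsPath q (es ++ fs) q' ↔ ∃ r, D.IsPath q es r ∧ D.IsPath r fs q' := by
  induction es generalizing q with
  | nil => simp [DetAut.IsPath]
  | cons e es ih => simp [DetAut.IsPath, ih, and_assoc]

/-- A path can be made simple by cutting out the segments between equal transitions. This keeps the
endpoints and the first and last transitions, and every relation that holds between successive
transitions. -/
theorem DetAut.IsPath.exists_nodup {D : DetAut α Q} {R : Q × α → Q × α → Prop} {q q' : Q}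
    {es : List (Q × α)} (h : D.IsPath q es q') (hR : es.IsChain R) :
    ∃ fs, D.IsPath q fs q' ∧ fs.Nodup ∧ fs.IsChain R ∧ fs.head? = es.head? ∧
      fs.getLast? = es.getLast? := by
  induction es generalizing q with
  | nil => exact ⟨[], h, by simp, by simp, rfl, rfl⟩
  | cons e es ih =>
    obtain ⟨he, hes⟩ := h
    rw [List.isChain_cons] at hR
    obtain ⟨fs, hp, hn, hc, hh, hl⟩ := ih hes hR.2
    by_cases hmem : e ∈ fs
    -- The segment before the second occurrence of `e` is cut out together with the first one.
    · obtain ⟨l₁, l₂, rfl⟩ := List.append_of_mem hmem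
      obtain ⟨r, -, hr⟩ := D.isPath_append.1 hp
      refine ⟨e :: l₂, ⟨he, hr.2⟩, (List.nodup_append.1 hn).2.1,
        (List.isChain_append.1 hc).2.1, rfl, ?_⟩
      cases es with
      | nil => simp at hl
      | cons a as => rw [List.getLast?_cons_cons, ← hl, List.getLast?_append_cons]
    · refine ⟨e :: fs, ⟨he, hp⟩, List.nodup_cons.2 ⟨hmem, hn⟩,
        List.isChain_cons.2 ⟨by rw [hh]; exact hR.1, hc⟩, rfl, ?_⟩
      simp [List.getLast?_cons, hl]

/-- A path to a target followed by a closed path there can be shortened to a lasso. The two parts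
are made simple separately; the pair of transitions at their junction stays the same. -/
theorem DetAut.exists_lasso_isChain {D : DetAut α Q} {F : Set Q} {R : Q × α → Q × α → Prop} {g : Q}
    {es fs : List (Q × α)} (hg : g ∈ F) (hes : D.IsPath D.start es g) (hfs : D.IsPath g fs g)
    (hne : fs ≠ []) (hR : (es ++ fs).IsChain R) :
    ∃ ρ ∈ lassos D F, ρ.edges.IsChain R := by
  rw [List.isChain_append] at hR
  obtain ⟨stem, hsp, hsn, hsc, -, hsl⟩ := hes.exists_nodup hR.1
  obtain ⟨cyc, hcp, hcn, hcc, hch, -⟩ := hfs.exists_nodup hR.2.1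
  refine ⟨⟨stem, cyc⟩, ⟨g, hg, hsp, hsn, hcp, ?_, hcn⟩, ?_⟩
  · rintro rfl
    exact hne (by simpa using hch.symm)
  · refine List.isChain_append.2 ⟨hsc, hcc, ?_⟩
    rw [hsl, hch]
    exact hR.2.2

theorem DetAut.isPath_run (D : DetAut α Q) (w : ℕ → α) (a k : ℕ) :
    D.IsPath (D.run w a) ((List.range' a k).map fun t => (D.run w t, w t)) (D.run w (a + k)) := by
  induction k generalizing a with
  | zero => rfl
  | succ k ih =>
    refine ⟨rfl, ?_⟩
    have := ih (a + 1)
    rwa [Nat.add_right_comm] at this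

theorem isChain_map_range' {β : Type*} {R : β → β → Prop} {e : ℕ → β}
    (h : ∀ t, R (e t) (e (t + 1))) (a k : ℕ) : ((List.range' a k).map e).IsChain R := by
  induction k generalizing a with
  | zero => simp
  | succ k ih =>
    rw [List.range'_succ, List.map_cons, List.isChain_cons]
    refine ⟨?_, ih (a + 1)⟩
    cases k <;> simp [List.range'_succ, h a]

/-- An accepting run yields a lasso all of whose pairs of successive transitions satisfy a relation
that holds along the run. -/
theorem DRA.Accepts.exists_lasso_isChain {D : DRA α Q} {w : ℕ → α} (hw : D.Accepts w)
    {R : Q × α → Q × α → Prop} (h : ∀ t, R (D.run w t, w t) (D.run w (t + 1), w (t + 1))) :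
    ∃ ρ ∈ lassos D.toDetAut D.targets, ρ.edges.IsChain R := by
  obtain ⟨i, ⟨g, hg, hgi⟩, -⟩ := hw
  obtain ⟨a, -, ha⟩ := Filter.frequently_atTop.1 hg 0
  obtain ⟨b, hb, hb'⟩ := Filter.frequently_atTop.1 hg (a + 1)
  obtain ⟨k, rfl⟩ := Nat.exists_eq_add_of_le hb
  have h₁ := D.isPath_run w 0 a
  have h₂ := D.isPath_run w a (1 + k)
  rw [Nat.zero_add, ha] at h₁
  rw [← Nat.add_assoc, ha, hb'] at h₂
  refine DetAut.exists_lasso_isChain (Set.mem_iUnion.2 ⟨i, hgi⟩) h₁ h₂ ?_ ?_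
  · simp
  · rw [← List.map_append]
    have := List.range'_append (s := 0) (m := a) (n := 1 + k) (step := 1)
    rw [Nat.zero_add, Nat.one_mul] at this
    rw [this]
    exact isChain_map_range' h _ _

theorem lassos_finite [Finite α] [Finite Q] (D : DetAut α Q) (F : Set Q) :
    (lassos D F).Finite := by
  classical
  have := Fintype.ofFinite (Q × α)
  have hfin : {es : List (Q × α) | es.Nodup}.Finite :=
    (List.finite_length_le (Q × α) (Fintype.card (Q × α))).subset
      fun es (hes : es.Nodup) => hes.length_le_card
  refine ((hfin.prod hfin).image fun x => (⟨x.1, x.2⟩ : Lasso α Q)).subset ?_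
  rintro ⟨s, c⟩ ⟨g, -, -, hs, -, -, hc⟩
  exact ⟨(s, c), ⟨hs, hc⟩, rfl⟩

end Paths

/-! ### Quantifier prefixes -/

/-- With an `∀ ∃` prefix, the existential inputs can be chosen jointly once all states and all
universal inputs are known. -/
theorem Alternating.exists_input {X W : Type*} {l : ℕ} {p : ℕ} {μ : Fin p → Quant}
    {P : (Fin p → X) → (Fin p → W) → Prop} (h : Alternating p μ P)
    (hμ : ∀ i : Fin p, i.val < l → μ i = .all) (x : Fin p → X) (u : Fin p → W) :
    ∃ w : Fin p → W, (∀ i : Fin p, i.val < l → w i = u i) ∧ P x w := by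
  induction p generalizing l with
  | zero =>
    refine ⟨u, fun _ _ => rfl, ?_⟩
    rwa [Subsingleton.elim x Fin.elim0, Subsingleton.elim u Fin.elim0]
  | succ k ih =>
    -- For `l = 0` the truncated `l - 1 = 0` is the right bound for the tail as well.
    have htail : ∀ i : Fin k, i.val < l - 1 → μ i.succ = .all := fun i hi =>
      hμ _ (by rw [Fin.val_succ]; omega)
    have key : ∃ w₀ : W, (0 < l → w₀ = u 0) ∧ Alternating k (fun i => μ i.succ)
        (fun xs ws => P (Fin.cons (x 0) xs) (Fin.cons w₀ ws)) := by
      have h0 := h (x 0)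
      split at h0
      · exact ⟨u 0, fun _ => rfl, h0 (u 0)⟩
      · next hex =>
        obtain ⟨w₀, hw₀⟩ := h0
        refine ⟨w₀, fun hl => ?_, hw₀⟩
        rw [hμ 0 hl] at hex
        cases hex
    obtain ⟨w₀, hw₀, hA⟩ := key
    obtain ⟨ws, hws, hP⟩ := ih hA htail (Fin.tail x) (Fin.tail u)
    refine ⟨Fin.cons w₀ ws, ?_, ?_⟩
    · intro i
      refine Fin.cases (fun hi => hw₀ hi) (fun j hj => ?_) i
      rw [Fin.val_succ] at hj
      exact hws j (by omega)
    · have hx : (Fin.cons (x 0) (Fin.tail x) : Fin (k + 1) → X) = x := Fin.cons_self_tail x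
      rwa [hx] at hP

section Formulas

variable {AP : Type*} {p : ℕ} {T : Set (Trace AP)} {μ : Fin p → Quant} {φ : HyperLTL AP (Fin p)}
  {xs : List (Fin p)}

/-- Satisfaction under a block of universal quantifiers. -/
theorem satVal_foldr_all (hμ : ∀ i ∈ xs, μ i = .all) {V : Valuation AP (Fin p)}
    (h : ∀ V' : Valuation AP (Fin p), (∀ i ∉ xs, V' i = V i) → (∀ i ∈ xs, V' i ∈ T) →
      φ.SatVal T V') :
    (xs.foldr (fun i φ => match μ i with
      | .all => HyperLTL.all i φ
      | .ex => HyperLTL.ex i φ) φ).SatVal T V := by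
  induction xs generalizing V with
  | nil => exact h V (fun _ _ => rfl) (by simp)
  | cons i xs ih =>
    rw [List.foldr_cons, hμ i List.mem_cons_self]
    intro σ hσ
    refine ih (fun j hj => hμ j (List.mem_cons_of_mem _ hj)) fun V' hV hT => h V' ?_ ?_
    · intro j hj
      rw [List.mem_cons, not_or] at hj
      rw [hV j hj.2, Function.update_of_ne hj.1]
    · intro j hj
      by_cases hjx : j ∈ xs
      · exact hT j hjx
      · obtain rfl := (List.mem_cons.1 hj).resolve_right hjx
        rwa [hV j hjx, Function.update_self]

/-- Satisfaction under a block of existential quantifiers. -/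
theorem satVal_foldr_ex (hμ : ∀ i ∈ xs, μ i = .ex) {V V' : Valuation AP (Fin p)}
    (hV : ∀ i ∉ xs, V' i = V i) (hT : ∀ i ∈ xs, V' i ∈ T) (h : φ.SatVal T V') :
    (xs.foldr (fun i φ => match μ i with
      | .all => HyperLTL.all i φ
      | .ex => HyperLTL.ex i φ) φ).SatVal T V := by
  induction xs generalizing V with
  | nil => rwa [List.foldr_nil, ← funext fun i => hV i (by simp)]
  | cons i xs ih =>
    rw [List.foldr_cons, hμ i List.mem_cons_self]
    refine ⟨V' i, hT i List.mem_cons_self, ih (fun j hj => hμ j (List.mem_cons_of_mem _ hj)) ?_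
      fun j hj => hT j (List.mem_cons_of_mem _ hj)⟩
    intro j hj
    by_cases hji : j = i
    · subst hji
      rw [Function.update_self]
    · rw [Function.update_of_ne hji, hV j (by simp [hji, hj])]

theorem models_prenex_forallExists {l : ℕ} {ψ : LTL (AP × Fin p)}
    (h : ∀ V : Valuation AP (Fin p), (∀ i, i.val < l → V i ∈ T) →
      ∃ V' : Valuation AP (Fin p), (∀ i, i.val < l → V' i = V i) ∧ (∀ i, V' i ∈ T) ∧ ψ.Sat V') :
    (prenex (forallExists p l) ψ).Models T := by
  have htake : ∀ i : Fin p, i ∈ (List.finRange p).take l ↔ i.val < l := by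
    intro i
    rw [List.mem_take_iff_getElem]
    constructor
    · rintro ⟨j, hj, rfl⟩
      simpa using (lt_min_iff.1 hj).1
    · intro hi
      exact ⟨i, by simp [hi], by simp⟩
  have hdrop : ∀ i : Fin p, i ∈ (List.finRange p).drop l ↔ l ≤ i.val := by
    intro i
    rw [List.mem_drop_iff_getElem]
    constructor
    · rintro ⟨j, hj, rfl⟩
      simp
    · intro hi
      exact ⟨i - l, by simp; omega, by simp [hi]⟩
  intro V
  rw [prenex, ← List.take_append_drop l (List.finRange p), List.foldr_append]
  refine satVal_foldr_all (fun i hi => if_pos ((htake i).1 hi)) fun V₁ _ hT => ?_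
  obtain ⟨V₂, hV₂, hT₂, hψ⟩ := h V₁ fun i hi => hT i ((htake i).2 hi)
  refine satVal_foldr_ex (V' := V₂) (fun i hi => if_neg (not_lt.2 ((hdrop i).1 hi))) ?_
    (fun i _ => hT₂ i) hψ
  intro i hi
  exact hV₂ i (not_le.1 fun hl => hi ((hdrop i).2 hl))

end Formulas

/-! ### Executions of the procedure -/

section Executions

variable {AP Q : Type*} {n m p : ℕ} {S : System n m} {L : S.X → Set AP} {μ : Fin p → Quant}
  {D : DetAut (Letter AP p) Q} {F : Set Q}

theorem isSelection_empty (r : Q) : IsSelection S L μ D F r fun _ => ∅ :=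
  fun _ => ⟨fun _ h => h.elim, 0, fun _ h => h.elim⟩

/-- Bounds the number of iterations that remain: the number of unvisited states plus the number
of waiting states, plus one for the final answer. -/
noncomputable def Config.rank {α Q : Type*} : Config α Q → ℕ
  | .running V visited _ => visitedᶜ.ncard + V.ncard + 1
  | .verified => 0
  | .inconclusive => 0

theorem Step.rank_lt [Finite Q] {C C' : Config (Letter AP p) Q} (h : Step S L μ D F C C') :
    C'.rank < C.rank := by
  cases h with
  | accept => simp [Config.rank]
  | giveUp => simp [Config.rank]
  | _ V visited Rd r c hr hc hrest =>
    simp only [Config.rank]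
    generalize hN : newStates D F r visited (Rd ∪ denied D F r c) = N
    have hNv : N ⊆ visitedᶜ := by
      rw [← hN]
      exact fun q hq => hq.1
    have h₁ : (visited ∪ N)ᶜ.ncard + N.ncard = visitedᶜ.ncard := by
      rw [Set.compl_union, ← Set.sdiff_eq]
      exact Set.ncard_sdiff_add_ncard_of_subset hNv
    have h₂ : ((V ∪ N) \ {r}).ncard + 1 = (V ∪ N).ncard :=
      Set.ncard_sdiff_singleton_add_one (Or.inl hr)
    have h₃ := Set.ncard_union_le V N
    omega

theorem terminates [Finite Q] : Terminates S L μ D F := by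
  constructor
  · rintro ⟨C, -, hC⟩
    obtain ⟨k, hk⟩ := WellFounded.not_rel_apply_succ (r := (· < ·)) fun k => (C k).rank
    exact hk (hC k).rank_lt
  · rintro (⟨V, visited, Rd⟩ | _ | _) -
    · right
      right
      rcases V.eq_empty_or_nonempty with rfl | ⟨r, hr⟩
      · exact ⟨_, .giveUp visited Rd⟩
      · by_cases h : lassos D F \ (Rd ∪ denied D F r fun _ => ∅) = ∅
        · exact ⟨_, .accept V visited Rd r _ hr (isSelection_empty r) h⟩
        · exact ⟨_, .continue V visited Rd r _ hr (isSelection_empty r) h⟩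
    · exact Or.inl rfl
    · exact Or.inr (Or.inl rfl)

/-- What holds of the configurations of an execution: the lassos denied so far are denied by a
family of selections, one for each state, that is empty at the states not yet processed. -/
def Config.Justified (S : System n m) (L : S.X → Set AP) (μ : Fin p → Quant)
    (D : DetAut (Letter AP p) Q) (F : Set Q) : Config (Letter AP p) Q → Prop
  | .running V visited Rd => V ⊆ visited ∧
      ∃ c : Q → Letter AP p → Set (Letter AP p), (∀ r, IsSelection S L μ D F r (c r)) ∧
        (∀ r, r ∈ V ∨ r ∉ visited → c r = fun _ => ∅) ∧ Rd ⊆ ⋃ r, denied D F r (c r)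
  | .verified => ∃ c : Q → Letter AP p → Set (Letter AP p),
      (∀ r, IsSelection S L μ D F r (c r)) ∧ lassos D F ⊆ ⋃ r, denied D F r (c r)
  | .inconclusive => True

theorem denied_empty (r : Q) : denied D F r (fun _ => ∅) = ∅ :=
  Set.eq_empty_of_forall_notMem fun _ ⟨_, _, _, h, _⟩ => h

/-- Recording the selection made at a state that had none so far. -/
theorem denied_union_subset_update [DecidableEq Q] {Rd : Set (Lasso (Letter AP p) Q)} {r : Q}
    {c : Letter AP p → Set (Letter AP p)} {d : Q → Letter AP p → Set (Letter AP p)}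
    (hd : d r = fun _ => ∅) (hRd : Rd ⊆ ⋃ q, denied D F q (d q)) :
    Rd ∪ denied D F r c ⊆ ⋃ q, denied D F q (Function.update d r c q) := by
  rintro ρ (hρ | hρ)
  · obtain ⟨q, hq⟩ := Set.mem_iUnion.1 (hRd hρ)
    have hqr : q ≠ r := by
      rintro rfl
      rw [hd, denied_empty] at hq
      exact hq
    exact Set.mem_iUnion.2 ⟨q, by rwa [Function.update_of_ne hqr]⟩
  · exact Set.mem_iUnion.2 ⟨r, by rwa [Function.update_self]⟩

theorem Step.justified {C C' : Config (Letter AP p) Q} (h : Step S L μ D F C C')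
    (hC : C.Justified S L μ D F) : C'.Justified S L μ D F := by
  classical
  have hupd : ∀ {d : Q → Letter AP p → Set (Letter AP p)} {r c},
      (∀ q, IsSelection S L μ D F q (d q)) → IsSelection S L μ D F r c →
      ∀ q, IsSelection S L μ D F q (Function.update d r c q) := by
    intro d r c hd hc q
    by_cases hq : q = r
    · subst hq
      rwa [Function.update_self]
    · rw [Function.update_of_ne hq]
      exact hd q
  cases h with
  | accept V visited Rd r c hr hc hdone =>
    obtain ⟨-, d, hd, hempty, hRd⟩ := hC
    exact ⟨Function.update d r c, hupd hd hc, (Set.sdiff_eq_empty.1 hdone).trans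
      (denied_union_subset_update (hempty r (Or.inl hr)) hRd)⟩
  | giveUp => trivial
  | _ V visited Rd r c hr hc hrest =>
    obtain ⟨hV, d, hd, hempty, hRd⟩ := hC
    refine ⟨Set.sdiff_subset.trans (Set.union_subset_union_left _ hV), Function.update d r c,
      hupd hd hc, ?_, denied_union_subset_update (hempty r (Or.inl hr)) hRd⟩
    intro q hq
    have hqr : q ≠ r := by
      rintro rfl
      rcases hq with hq | hq
      · exact hq.2 rfl
      · exact hq (Or.inl (hV hr))
    rw [Function.update_of_ne hqr]
    apply hempty
    rcases hq with ⟨hq | hq, -⟩ | hq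
    · exact Or.inl hq
    · exact Or.inr hq.1
    · exact Or.inr fun h => hq (Or.inl h)

theorem exists_selection_of_reaches_verified (h : Reaches S L μ D F .verified) :
    ∃ c : Q → Letter AP p → Set (Letter AP p), (∀ r, IsSelection S L μ D F r (c r)) ∧
      lassos D F ⊆ ⋃ r, denied D F r (c r) := by
  have key : ∀ C, Reaches S L μ D F C → C.Justified S L μ D F := by
    intro C hC
    induction hC with
    | refl =>
      exact ⟨subset_rfl, fun _ _ => ∅, isSelection_empty, fun _ _ => rfl, Set.empty_subset _⟩
    | tail _ hstep ih => exact hstep.justified ih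
  exact key _ h

end Executions

/-! ### Soundness -/

section Soundness

variable {AP Q : Type*} {n m p l : ℕ} {S : System n m} {L : S.X → Set AP}
  {D : DetAut (Letter AP p) Q} {F : Set Q}

/-- The certificate shared by the pairs that start with the current label provides inputs for which
the next label is not selected. -/
theorem IsSelection.exists_input {r : Q} {c : Letter AP p → Set (Letter AP p)}
    (hc : IsSelection S L (forallExists p l) D F r c) (x : Fin p → S.X) (u : Fin p → S.W) :
    ∃ w : Fin p → S.W, (∀ i : Fin p, i.val < l → w i = u i) ∧
      augLabel L (S.augStep x w) ∉ c (augLabel L x) := by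
  obtain ⟨-, b, hb⟩ := hc (augLabel L x)
  rcases (c (augLabel L x)).eq_empty_or_nonempty with he | ⟨sB, hsB⟩
  · exact ⟨u, fun _ _ => rfl, by simp [he]⟩
  · obtain ⟨hneg, -, hstep⟩ := hb sB hsB
    obtain ⟨w, hw, hle⟩ := hstep.exists_input (fun i hi => if_pos hi) x u
    refine ⟨w, hw, fun hmem => ?_⟩
    have hpos := (hb _ hmem).2.1 (S.augStep x w) rfl
    have hx := hneg x rfl
    linarith

/-- The joint run of the automaton and the augmented system, where the inputs are chosen by the
strategy `w` from the state of the automaton, that of the system, and the proposed inputs `ν`. -/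
def jointRun (S : System n m) (L : S.X → Set AP) (D : DetAut (Letter AP p) Q)
    (w : Q → (Fin p → S.X) → (Fin p → S.W) → Fin p → S.W) (x₀ : Fin p → S.X)
    (ν : ℕ → Fin p → S.W) : ℕ → Q × (Fin p → S.X)
  | 0 => (D.start, x₀)
  | t + 1 =>
    let y := jointRun S L D w x₀ ν t
    (D.step y.1 (augLabel L y.2), S.augStep y.2 (w y.1 y.2 (ν t)))

/-- Traces of the existentially quantified components can be chosen such that no two successive
transitions of the automaton match the selections. -/
theorem exists_traces_avoiding (hX : S.X.Nonempty) (hW : S.W.Nonempty)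
    {c : Q → Letter AP p → Set (Letter AP p)}
    (hc : ∀ r, IsSelection S L (forallExists p l) D F r (c r)) (V : Valuation AP (Fin p))
    (hV : ∀ i : Fin p, i.val < l → V i ∈ S.traces L) :
    ∃ V' : Valuation AP (Fin p), (∀ i : Fin p, i.val < l → V' i = V i) ∧
      (∀ i, V' i ∈ S.traces L) ∧
      ∀ t, (fun i => V' i (t + 1)) ∉ c (D.run (fun t i => V' i t) t) (fun i => V' i t) := by
  have hinit : ∀ i : Fin p, ∃ (x₀ : S.X) (ν : ℕ → S.W),
      i.val < l → V i = fun t => L (S.run x₀ ν t) := by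
    intro i
    by_cases hi : i.val < l
    · obtain ⟨x₀, ν, h⟩ := hV i hi
      exact ⟨x₀, ν, fun _ => h⟩
    · exact ⟨⟨_, hX.some_mem⟩, fun _ => ⟨_, hW.some_mem⟩, fun h => absurd h hi⟩
  choose x₀ ν hν using hinit
  choose w hw hwc using fun q => (hc q).exists_input
  set y := jointRun S L D w x₀ fun t i => ν i t
  have hrun : ∀ i t, S.run (x₀ i) (fun t => w (y t).1 (y t).2 (fun i => ν i t) i) t
      = (y t).2 i := by
    intro i t
    induction t with
    | zero => rfl
    | succ t ih => rw [System.run, ih]; rfl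
  have haut : ∀ t, D.run (fun t i => L ((y t).2 i)) t = (y t).1 := by
    intro t
    induction t with
    | zero => rfl
    | succ t ih => rw [DetAut.run, ih]; rfl
  refine ⟨fun i t => L ((y t).2 i), fun i hi => ?_, fun i => ?_, fun t => ?_⟩
  · rw [hν i hi]
    funext t
    have hinp : (fun t => w (y t).1 (y t).2 (fun i => ν i t) i) = ν i :=
      funext fun t => hw _ _ _ i hi
    change L ((y t).2 i) = _
    rw [← hrun i t, hinp]
  · exact ⟨_, _, funext fun t => by rw [hrun i t]⟩
  · rw [haut]
    exact hwc (y t).1 (y t).2 fun i => ν i t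

theorem models_of_reaches_verified (hX : S.X.Nonempty) (hW : S.W.Nonempty)
    {ψ : LTL (AP × Fin p)} {D : DRA (Letter AP p) Q} (hD : D.RecognizesNeg ψ)
    (h : Reaches S L (forallExists p l) D.toDetAut D.targets .verified) :
    (prenex (forallExists p l) ψ).Models (S.traces L) := by
  obtain ⟨c, hc, hden⟩ := exists_selection_of_reaches_verified h
  refine models_prenex_forallExists fun V hV => ?_
  obtain ⟨V', hVV', hT, hav⟩ := exists_traces_avoiding hX hW hc V hV
  refine ⟨V', hVV', hT, ?_⟩
  by_contra hψ
  obtain ⟨ρ, hρ, hchain⟩ := ((hD V').2 hψ).exists_lasso_isChain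
    (R := fun e e' => e'.2 ∉ c e.1 e.2) hav
  obtain ⟨r, -, sA, sB, hsB, hinf⟩ := Set.mem_iUnion.1 (hden hρ)
  have := hchain.infix hinf
  rw [List.isChain_pair] at this
  exact this hsB

end Soundness

end HyperABC

theorem mainTheorem9 {AP : Type*} [Finite AP] {Q : Type*} [Finite Q] {n m p l : ℕ} (hl : l ≤ p)
    (S : HyperABC.System n m) (hX : S.X.Nonempty) (hW : S.W.Nonempty) (L : S.X → Set AP)
    (ψ : HyperABC.LTL (AP × Fin p))
    (D : HyperABC.DRA (HyperABC.Letter AP p) Q) (hD : D.RecognizesNeg ψ) :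
    (HyperABC.lassos D.toDetAut D.targets).Finite ∧
    HyperABC.Terminates S L (HyperABC.forallExists p l) D.toDetAut D.targets ∧
    (HyperABC.Reaches S L (HyperABC.forallExists p l) D.toDetAut D.targets .verified →
      (HyperABC.prenex (HyperABC.forallExists p l) ψ).Models (S.traces L)) := by
  exact ⟨HyperABC.lassos_finite _ _, HyperABC.terminates,
    HyperABC.models_of_reaches_verified hX hW hD⟩
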